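/- Let $(X,m)$ be a measure space and let $L^2(X,m)$ be the Hilbert space of real-valued (or of complex-valued) square integrable functions, with norm $\|\cdot\|$. Let $h$ be a densely defined, symmetric sesquilinear form on $L^2(X,m)$ with domain $D(h)$ and write $h(u):=h(u,u)$. Suppose that $h$ is bounded from below, i.e. $h(u)\ge c\|u\|^2$ for some $c\in\mathbb R$ and all $u\in D(h)$, and closed, i.e. $D(h)$ is complete with respect to the norm $\|u\|_h=(h(u)-c\|u\|^2+\|u\|^2)^{1/2}$. Let $H$ be the corresponding self-adjoint operator: $u\in D(H)$ and $Hu=w$ if and only if $u\in D(h)$ and $h(v,u)=\langle v,w\rangle$ for all $v\in D(h)$. Let $\sigma_{\mathrm{ess}}(H)$ be its essential spectrum, i.e. the set of all points of the spectrum of $H$ that are not isolated points of the spectrum which are eigenvalues of finite multiplicity, and let $\lambda_0^{\mathrm{ess}}(H):=\inf\sigma_{\mathrm{ess}}(H)$, with $\inf\emptyset=+\infty$. If there is a sequence $(f_n)$ in $D(h)$ with $\|f_n\|=1$ for all $n$ that converges weakly to zero in $L^2(X,m)$, then $$\lambda_0^{\mathrm{ess}}(H)\le\liminf_{n\to\infty}h(f_n),$$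 as an inequality in $[-\infty,+\infty]$. -/

import Mathlib

open Filter Topology MeasureTheory
open scoped ComplexConjugate ENNReal InnerProductSpace

/-- A densely defined symmetric sesquilinear form `(h, D(h))` on a real or complex inner product
space `E`: conjugate-linear in the first argument, linear in the second one, and Hermitian. -/
structure DenselyDefinedForm (𝕜 E : Type*) [RCLike 𝕜] [NormedAddCommGroup E]
    [InnerProductSpace 𝕜 E] where
  /-- The form domain `D(h)`. -/
  domain : Submodule 𝕜 E
  dense_domain : Dense (domain : Set E)
  /-- The sesquilinear form `h(u, v)`. -/
  form : domain →ₗ⋆[𝕜] domain →ₗ[𝕜] 𝕜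
  symm : ∀ u v : domain, conj (form u v) = form v u

namespace DenselyDefinedForm

variable {𝕜 E : Type*} [RCLike 𝕜] [NormedAddCommGroup E] [InnerProductSpace 𝕜 E]

/-- The quadratic form `h(u) = h(u, u)`, which is real because the form is Hermitian. -/
noncomputable def quad (h : DenselyDefinedForm 𝕜 E) (u : h.domain) : ℝ :=
  RCLike.re (h.form u u)

/-- `c` is a lower bound of `h`: `c ‖u‖² ≤ h(u)` for all `u ∈ D(h)`. -/
def IsLowerBound (h : DenselyDefinedForm 𝕜 E) (c : ℝ) : Prop :=
  ∀ u : h.domain, c * ‖(u : E)‖ ^ 2 ≤ h.quad u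

/-- The form is bounded from below. -/
def IsBoundedBelow (h : DenselyDefinedForm 𝕜 E) : Prop :=
  ∃ c : ℝ, h.IsLowerBound c

/-- The form norm `(h(u) - c ‖u‖² + ‖u‖²)^(1/2)` of a form with lower bound `c`; different lower
bounds give equivalent norms. -/
noncomputable def formNorm (h : DenselyDefinedForm 𝕜 E) (c : ℝ) (u : h.domain) : ℝ :=
  Real.sqrt (h.quad u - c * ‖(u : E)‖ ^ 2 + ‖(u : E)‖ ^ 2)

/-- A form that is bounded from below is closed if `D(h)` is complete for the form norm: every
Cauchy sequence of `D(h)` converges to an element of `D(h)`. -/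
def IsClosed (h : DenselyDefinedForm 𝕜 E) : Prop :=
  ∀ c : ℝ, h.IsLowerBound c → ∀ u : ℕ → h.domain,
    (∀ ε : ℝ, 0 < ε → ∃ N : ℕ, ∀ k ≥ N, ∀ l ≥ N, h.formNorm c (u k - u l) < ε) →
      ∃ v : h.domain, Tendsto (fun n => h.formNorm c (u n - v)) atTop (𝓝 0)

/-- The graph of the operator `H` associated with the form `h`: the pairs `(u, w)` such that
`u ∈ D(h)` and `h(v, u) = ⟪v, w⟫` for all `v ∈ D(h)`. -/
def operatorGraph (h : DenselyDefinedForm 𝕜 E) : Submodule 𝕜 (E × E) where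
  carrier := {p | ∃ u : h.domain, (u : E) = p.1 ∧ ∀ v : h.domain, h.form v u = ⟪(v : E), p.2⟫_𝕜}
  zero_mem' := ⟨0, by simp, by simp⟩
  add_mem' := by
    rintro _ _ ⟨u, hu, hu'⟩ ⟨w, hw, hw'⟩
    exact ⟨u + w, by simp [hu, hw], fun v => by simp [hu', hw', inner_add_right]⟩
  smul_mem' := by
    rintro a _ ⟨u, hu, hu'⟩
    exact ⟨a • u, by simp [hu], fun v => by simp [hu', inner_smul_right]⟩

/-- The (in general unbounded) operator `H` associated with the form `h`:
`u ∈ D(H)` and `H u = w` if and only if `u ∈ D(h)` and `h(v, u) = ⟪v, w⟫` for all `v ∈ D(h)`. -/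
noncomputable def operator (h : DenselyDefinedForm 𝕜 E) : E →ₗ.[𝕜] E :=
  h.operatorGraph.toLinearPMap

/-- As `D(h)` is dense, `operatorGraph` is the graph of a map, so `operator` is well defined. -/
theorem graph_operator (h : DenselyDefinedForm 𝕜 E) : h.operator.graph = h.operatorGraph := by
  refine Submodule.toLinearPMap_graph_eq _ ?_
  rintro ⟨x, w⟩ ⟨u, hu, huw⟩ hx
  obtain rfl : u = 0 := by
    ext
    simpa [hu] using hx
  refine h.dense_domain.eq_zero_of_inner_right 𝕜 fun v hv => ?_
  simpa using (huw ⟨v, hv⟩).symm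

end DenselyDefinedForm

namespace LinearPMap

variable {𝕜 E : Type*} [RCLike 𝕜] [NormedAddCommGroup E] [InnerProductSpace 𝕜 E]

/-- The resolvent set of an unbounded operator `T`: all scalars `z` for which
`T - z : D(T) → E` has an everywhere defined bounded two-sided inverse. -/
def resolventSet (T : E →ₗ.[𝕜] E) : Set 𝕜 :=
  {z | ∃ R : E →L[𝕜] E,
    (∀ x : E, ∃ u : T.domain, (u : E) = R x ∧ T u - z • (u : E) = x) ∧
      ∀ u : T.domain, R (T u - z • (u : E)) = u}

/-- The spectrum of an unbounded operator. For a self-adjoint operator on a real space it is the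
same set of real numbers as the spectrum of the complexified operator. -/
def spectrum (T : E →ₗ.[𝕜] E) : Set 𝕜 :=
  (T.resolventSet)ᶜ

/-- The eigenspace `ker (T - z)`, as a subspace of `D(T)`. -/
def eigenspace (T : E →ₗ.[𝕜] E) (z : 𝕜) : Submodule 𝕜 T.domain :=
  LinearMap.ker (T.toFun - z • T.domain.subtype)

/-- The discrete spectrum: the isolated points of the spectrum that are eigenvalues of finite
multiplicity. -/
def discreteSpectrum (T : E →ₗ.[𝕜] E) : Set 𝕜 :=
  {z | z ∈ T.spectrum ∧ ¬ AccPt z (𝓟 T.spectrum) ∧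
    T.eigenspace z ≠ ⊥ ∧ FiniteDimensional 𝕜 (T.eigenspace z)}

/-- The essential spectrum (of a self-adjoint operator): the complement of the discrete spectrum
in the spectrum. -/
def essentialSpectrum (T : E →ₗ.[𝕜] E) : Set 𝕜 :=
  T.spectrum \ T.discreteSpectrum

/-- The bottom `inf σ_ess(T)` of the essential spectrum of a self-adjoint operator, as an extended
real number, with `inf ∅ = ∞`. As `σ_ess(T)` is real, taking real parts only changes the type. -/
noncomputable def essentialSpectrumBottom (T : E →ₗ.[𝕜] E) : EReal :=
  ⨅ z ∈ T.essentialSpectrum, ((RCLike.re z : ℝ) : EReal)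

end LinearPMap

/-! Let `G` be the set of numbers `t` with `h ≥ t` on `D(h) ∩ Vᗮ` for some finite dimensional `V ≤
D(h)`. Every `t ∈ G` lies below the liminf: a weakly null sequence is asymptotically orthogonal to
`V`, and its projections to `V` tend to zero in form norm because `V` is a finite dimensional part
of `D(h)` (`le_liminf_quad`). If the liminf is a real number, `G` is therefore bounded above, and
its supremum `t` lies in the essential spectrum, which gives the claim.

Otherwise `T - t` would have a finite dimensional kernel `N` and a bounded inverse on `Nᗮ`. Testing
a lower bound just below `t` on `v - x (T - t)⁻¹ v` would then produce an element of `G` beyond `t`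
(`exists_improved_lowerBound`).

The inverse comes from resolvent estimates alone, without a spectral measure:
`IsFormalAdjoint.mul_norm_le` bounds `T - t` below by the distance to the real spectrum, and this
bound at `t ± s` controls the form of `T - t` near an isolated point `t`. -/

namespace LinearPMap

variable {𝕜 E : Type*} [RCLike 𝕜] [NormedAddCommGroup E] [InnerProductSpace 𝕜 E]

/-! ### Resolvent estimates for symmetric operators at real points. -/

/-- `R` is the resolvent `(T - z)⁻¹`. -/
def IsResolvent (T : E →ₗ.[𝕜] E) (z : 𝕜) (R : E →L[𝕜] E) : Prop :=
  (∀ x : E, ∃ u : T.domain, (u : E) = R x ∧ T u - z • (u : E) = x) ∧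
    ∀ u : T.domain, R (T u - z • (u : E)) = u

theorem mem_resolventSet_iff {T : E →ₗ.[𝕜] E} {z : 𝕜} :
    z ∈ T.resolventSet ↔ ∃ R, T.IsResolvent z R := Iff.rfl

theorem IsFormalAdjoint.inner_sub_smul {T : E →ₗ.[𝕜] E} (hT : T.IsFormalAdjoint T) (t : ℝ)
    (u v : T.domain) :
    ⟪T u - (t : 𝕜) • (u : E), (v : E)⟫_𝕜 = ⟪(u : E), T v - (t : 𝕜) • (v : E)⟫_𝕜 := by
  rw [inner_sub_left, inner_sub_right, inner_smul_left, inner_smul_right, hT u v, RCLike.conj_ofReal]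

theorem IsResolvent.inner_left {T : E →ₗ.[𝕜] E} (hT : T.IsFormalAdjoint T) {t : ℝ}
    {R : E →L[𝕜] E} (hR : T.IsResolvent (t : 𝕜) R) (x y : E) : ⟪R x, y⟫_𝕜 = ⟪x, R y⟫_𝕜 := by
  obtain ⟨u, hu, hux⟩ := hR.1 x
  obtain ⟨v, hv, hvy⟩ := hR.1 y
  rw [← hu, ← hv, ← hux, ← hvy, hT.inner_sub_smul]

/-- If `t ± ‖R‖⁻¹` are both regular points, `‖R²x‖` is controlled by `‖x - ‖R‖⁻² R²x‖`. -/
theorem IsResolvent.norm_sq_apply_le {T : E →ₗ.[𝕜] E} {t a : ℝ} {R R₁ R₂ : E →L[𝕜] E}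
    (hR : T.IsResolvent (t : 𝕜) R) (hR₁ : T.IsResolvent ((t + a : ℝ) : 𝕜) R₁)
    (hR₂ : T.IsResolvent ((t - a : ℝ) : 𝕜) R₂) (x : E) :
    ‖R (R x)‖ ≤ ‖R₂‖ * ‖R₁‖ * ‖x - ((a ^ 2 : ℝ) : 𝕜) • R (R x)‖ := by
  obtain ⟨u, hu, hux⟩ := hR.1 x
  obtain ⟨v, hv, hvx⟩ := hR.1 (R x)
  have h₁ : R₁ (x - ((a ^ 2 : ℝ) : 𝕜) • R (R x)) = R x + (a : 𝕜) • R (R x) := by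
    have := hR₁.2 (u + (a : 𝕜) • v)
    rw [map_add, map_smul, sub_eq_iff_eq_add.1 hux, sub_eq_iff_eq_add.1 hvx, Submodule.coe_add,
      Submodule.coe_smul, hv, hu] at this
    rw [← this]
    congr 1
    push_cast
    module
  have h₂ : R₂ (R x + (a : 𝕜) • R (R x)) = R (R x) := by
    have := hR₂.2 v
    rw [sub_eq_iff_eq_add.1 hvx] at this
    rw [← hv, ← this]
    congr 1
    rw [this]
    push_cast
    module
  calc ‖R (R x)‖ = ‖R₂ (R₁ (x - ((a ^ 2 : ℝ) : 𝕜) • R (R x)))‖ := by rw [h₁, h₂]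
    _ ≤ ‖R₂‖ * (‖R₁‖ * ‖x - ((a ^ 2 : ℝ) : 𝕜) • R (R x)‖) :=
      (R₂.le_opNorm _).trans (by gcongr; exact R₁.le_opNorm _)
    _ = _ := by ring

/-- For a symmetric operator, the distance to the real spectrum bounds `‖(T - t)u‖` from below. -/
theorem IsFormalAdjoint.mul_norm_le {T : E →ₗ.[𝕜] E} (hT : T.IsFormalAdjoint T) {t s : ℝ}
    (hs : 0 < s) (hρ : ∀ a : ℝ, |a| < s → ((t + a : ℝ) : 𝕜) ∈ T.resolventSet) (u : T.domain) :
    s * ‖(u : E)‖ ≤ ‖T u - (t : 𝕜) • (u : E)‖ := by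
  obtain ⟨R, hR⟩ : ∃ R, T.IsResolvent (t : 𝕜) R := by
    have := hρ 0 (by simpa using hs)
    rwa [add_zero] at this
  by_contra! hu
  have hle : ‖(u : E)‖ ≤ ‖R‖ * ‖T u - (t : 𝕜) • (u : E)‖ := by
    simpa [hR.2 u] using R.le_opNorm (T u - (t : 𝕜) • (u : E))
  have hu0 : 0 < ‖(u : E)‖ := by
    by_contra! h0
    nlinarith [norm_nonneg (u : E), norm_nonneg (T u - (t : 𝕜) • (u : E))]
  have hr : 0 < ‖R‖ := by
    by_contra! h0
    nlinarith [norm_nonneg (T u - (t : 𝕜) • (u : E))]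
  -- If the estimate fails, both `t ± ‖R‖⁻¹` are regular, so `1 - R² / ‖R‖²` is bounded below. This
  -- cannot happen, as `‖R‖²` is an approximate eigenvalue of `R²` for symmetric `R`.
  have hrs : ‖R‖⁻¹ < s := by
    rw [inv_lt_iff_one_lt_mul₀ hr]
    have : ‖(u : E)‖ < ‖R‖ * (s * ‖(u : E)‖) := hle.trans_lt (by gcongr)
    nlinarith
  set r := ‖R‖ with hrdef
  obtain ⟨R₁, hR₁⟩ := hρ r⁻¹ (by rwa [abs_of_pos (inv_pos.2 hr)])
  obtain ⟨R₂, hR₂⟩ := hρ (-r⁻¹) (by rwa [abs_neg, abs_of_pos (inv_pos.2 hr)])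
  rw [← sub_eq_add_neg] at hR₂
  set b : ℝ := r⁻¹ ^ 2 with hb
  have hb0 : 0 < b := by positivity
  have hbr : b * r ^ 2 = 1 := by rw [hb]; field_simp
  set M : ℝ := 1 + b * (‖R₂‖ * ‖R₁‖) with hM
  have hM1 : 1 ≤ M := by rw [hM]; have : 0 ≤ b * (‖R₂‖ * ‖R₁‖) := by positivity
                         linarith
  -- Combining `‖x‖ ≤ M ‖x - b R² x‖` with `‖x - b R² x‖² ≤ ‖x‖² - b ‖R x‖²` bounds `‖R x‖` by a
  -- factor strictly smaller than `‖R‖`.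
  have key : ∀ x, M ^ 2 * (b * ‖R x‖ ^ 2) ≤ (M ^ 2 - 1) * ‖x‖ ^ 2 := by
    intro x
    have h1 := hR.norm_sq_apply_le hR₁ hR₂ x
    rw [← hb] at h1
    have h2 : ‖x‖ ≤ M * ‖x - (b : 𝕜) • R (R x)‖ := by
      have h3 : ‖x‖ ≤ ‖x - (b : 𝕜) • R (R x)‖ + b * ‖R (R x)‖ := by
        have := norm_add_le (x - (b : 𝕜) • R (R x)) ((b : 𝕜) • R (R x))
        rwa [sub_add_cancel, norm_smul, RCLike.norm_ofReal, abs_of_pos hb0] at this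
      have h4 := mul_le_mul_of_nonneg_left h1 hb0.le
      rw [hM]; linarith
    have h5 : ‖x - (b : 𝕜) • R (R x)‖ ^ 2 ≤ ‖x‖ ^ 2 - b * ‖R x‖ ^ 2 := by
      rw [norm_sub_sq (𝕜 := 𝕜), inner_smul_right, RCLike.re_ofReal_mul, ← hR.inner_left hT,
        inner_self_eq_norm_sq, norm_smul, RCLike.norm_ofReal, abs_of_pos hb0]
      have h6 : ‖R (R x)‖ ^ 2 ≤ r ^ 2 * ‖R x‖ ^ 2 := by
        rw [← mul_pow]; gcongr; exact R.le_opNorm _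
      have h7 : b ^ 2 * ‖R (R x)‖ ^ 2 ≤ b * ‖R x‖ ^ 2 := by
        calc b ^ 2 * ‖R (R x)‖ ^ 2 ≤ b ^ 2 * (r ^ 2 * ‖R x‖ ^ 2) := by gcongr
          _ = (b * r ^ 2) * b * ‖R x‖ ^ 2 := by ring
          _ = _ := by rw [hbr, one_mul]
      rw [mul_pow]
      linarith
    have h8 : ‖x‖ ^ 2 ≤ M ^ 2 * ‖x - (b : 𝕜) • R (R x)‖ ^ 2 := by
      rw [← mul_pow]; gcongr
    nlinarith [mul_le_mul_of_nonneg_left h5 (sq_nonneg M)]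
  have hM2 : (M ^ 2 - 1) / M ^ 2 < 1 := by
    rw [div_lt_one (by positivity)]; linarith
  have hM0 : 0 ≤ (M ^ 2 - 1) / M ^ 2 := div_nonneg (by nlinarith) (by positivity)
  have hle : r ≤ r * Real.sqrt ((M ^ 2 - 1) / M ^ 2) := by
    refine R.opNorm_le_bound (by positivity) fun x => ?_
    refine le_of_sq_le_sq ?_ (by positivity)
    rw [mul_pow, mul_pow, Real.sq_sqrt hM0]
    have h1 := mul_le_mul_of_nonneg_left (key x) (sq_nonneg r)
    have h2 : r ^ 2 * (M ^ 2 * (b * ‖R x‖ ^ 2)) = M ^ 2 * ‖R x‖ ^ 2 := by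
      calc _ = (b * r ^ 2) * (M ^ 2 * ‖R x‖ ^ 2) := by ring
        _ = _ := by rw [hbr, one_mul]
    rw [h2] at h1
    rw [mul_assoc, div_mul_eq_mul_div, mul_div_assoc', le_div_iff₀ (by positivity)]
    linarith
  have : Real.sqrt ((M ^ 2 - 1) / M ^ 2) < 1 := by
    rw [Real.sqrt_lt' one_pos]; simpa using hM2
  nlinarith

/-- Near an isolated point `t` of the spectrum, `⟪(T - t)u, v⟫` is bounded by
`‖(T - t)u‖ ‖(T - t)v‖`. -/
theorem IsFormalAdjoint.re_inner_le {T : E →ₗ.[𝕜] E} (hT : T.IsFormalAdjoint T) {t s : ℝ}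
    (hs : 0 < s)
    (hρ : ∀ a : ℝ, a ≠ 0 → |a| < 2 * s → ((t + a : ℝ) : 𝕜) ∈ T.resolventSet) (u v : T.domain) :
    RCLike.re ⟪T u - (t : 𝕜) • (u : E), (v : E)⟫_𝕜 ≤
      (2 * s)⁻¹ * (‖T u - (t : 𝕜) • (u : E)‖ * ‖T v - (t : 𝕜) • (v : E)‖) := by
  -- The points `t ± s` have distance at least `s` from the real spectrum. Squaring the resulting
  -- bound on `(T - t - b) w`, the terms `s² ‖w‖²` cancel.
  have hlow : ∀ b : ℝ, |b| = s → ∀ w : T.domain,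
      b * (2 * RCLike.re ⟪T w - (t : 𝕜) • (w : E), (w : E)⟫_𝕜) ≤
        ‖T w - (t : 𝕜) • (w : E)‖ ^ 2 := by
    intro b hb w
    have h1 := hT.mul_norm_le (t := t + b) hs (fun a ha => by
      rw [add_assoc]
      have hab := abs_lt.1 ha
      refine hρ _ ?_ ?_
      · intro h0
        rw [show a = -b by linarith, abs_neg, hb] at ha
        exact lt_irrefl _ ha
      · exact (abs_add_le _ _).trans_lt (by linarith)) w
    have h2 : T w - ((t + b : ℝ) : 𝕜) • (w : E) =
        (T w - (t : 𝕜) • (w : E)) - (b : 𝕜) • (w : E) := by push_cast; module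
    have h3 : (s * ‖(w : E)‖) ^ 2 ≤ ‖T w - ((t + b : ℝ) : 𝕜) • (w : E)‖ ^ 2 := by gcongr
    rw [h2, norm_sub_sq (𝕜 := 𝕜), inner_smul_right, RCLike.re_ofReal_mul, norm_smul,
      RCLike.norm_ofReal, hb, mul_pow] at h3
    linarith
  have habs : ∀ w : T.domain, |2 * s * RCLike.re ⟪T w - (t : 𝕜) • (w : E), (w : E)⟫_𝕜| ≤
      ‖T w - (t : 𝕜) • (w : E)‖ ^ 2 := by
    intro w
    have h1 := hlow s (abs_of_pos hs) w
    have h2 := hlow (-s) (by rw [abs_neg, abs_of_pos hs]) w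
    exact abs_le.2 ⟨by linarith, by linarith⟩
  have hpol : ∀ u v : T.domain, 4 * s * RCLike.re ⟪T u - (t : 𝕜) • (u : E), (v : E)⟫_𝕜 ≤
      ‖T u - (t : 𝕜) • (u : E)‖ ^ 2 + ‖T v - (t : 𝕜) • (v : E)‖ ^ 2 := by
    intro u v
    have h1 := (abs_le.1 (habs (u + v))).2
    have h2 := (abs_le.1 (habs (u - v))).1
    have e1 : T (u + v) - (t : 𝕜) • ((u + v : T.domain) : E) =
        (T u - (t : 𝕜) • (u : E)) + (T v - (t : 𝕜) • (v : E)) := by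
      rw [map_add, Submodule.coe_add]; module
    have e2 : T (u - v) - (t : 𝕜) • ((u - v : T.domain) : E) =
        (T u - (t : 𝕜) • (u : E)) - (T v - (t : 𝕜) • (v : E)) := by
      rw [map_sub, Submodule.coe_sub]; module
    have hsym : RCLike.re ⟪T v - (t : 𝕜) • (v : E), (u : E)⟫_𝕜 =
        RCLike.re ⟪T u - (t : 𝕜) • (u : E), (v : E)⟫_𝕜 := by
      rw [hT.inner_sub_smul, inner_re_symm]
    rw [e1] at h1
    rw [e2] at h2
    have hpar := parallelogram_law_with_norm 𝕜 (T u - (t : 𝕜) • (u : E)) (T v - (t : 𝕜) • (v : E))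
    generalize T u - (t : 𝕜) • (u : E) = A at *
    generalize T v - (t : 𝕜) • (v : E) = B at *
    simp only [Submodule.coe_add, Submodule.coe_sub, inner_add_left, inner_add_right,
      inner_sub_left, inner_sub_right, _root_.map_add, _root_.map_sub] at h1 h2
    rw [hsym] at h1 h2
    linarith
  set α := ‖T u - (t : 𝕜) • (u : E)‖ with hα
  set β := ‖T v - (t : 𝕜) • (v : E)‖ with hβ
  -- Rescaling turns the sum of squares into a product through the discriminant, which also covers
  -- vanishing `α` or `β`.
  have hscale : ∀ x y : ℝ, x * y * (4 * s * RCLike.re ⟪T u - (t : 𝕜) • (u : E), (v : E)⟫_𝕜) ≤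
      x ^ 2 * α ^ 2 + y ^ 2 * β ^ 2 := by
    intro x y
    have := hpol ((x : 𝕜) • u) ((y : 𝕜) • v)
    have e : ∀ (x : ℝ) (u : T.domain), T ((x : 𝕜) • u) - (t : 𝕜) • (((x : 𝕜) • u : T.domain) : E) =
        (x : 𝕜) • (T u - (t : 𝕜) • (u : E)) := by
      intro x u; rw [map_smul, Submodule.coe_smul]; module
    rw [e, e, Submodule.coe_smul, inner_smul_left, inner_smul_right, RCLike.conj_ofReal,
      RCLike.re_ofReal_mul, RCLike.re_ofReal_mul, norm_smul, norm_smul, RCLike.norm_ofReal,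
      RCLike.norm_ofReal, mul_pow, mul_pow, sq_abs, sq_abs, ← hα, ← hβ] at this
    linarith
  rw [inv_mul_eq_div, le_div_iff₀ (by positivity)]
  have hdisc := discrim_le_zero (a := α ^ 2)
    (b := -(4 * s * RCLike.re ⟪T u - (t : 𝕜) • (u : E), (v : E)⟫_𝕜)) (c := β ^ 2) fun x => by
      have := hscale x 1
      linarith
  rw [discrim] at hdisc
  refine le_of_sq_le_sq ?_ (mul_nonneg (norm_nonneg _) (norm_nonneg _))
  linarith

theorem mem_map_eigenspace {T : E →ₗ.[𝕜] E} {z : 𝕜} {x : E} :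
    x ∈ (T.eigenspace z).map T.domain.subtype ↔
      ∃ u : T.domain, (u : E) = x ∧ T u - z • (u : E) = 0 := by
  rw [Submodule.mem_map]
  constructor
  · rintro ⟨u, hu, rfl⟩
    exact ⟨u, rfl, hu⟩
  · rintro ⟨u, rfl, hu⟩
    exact ⟨u, hu, rfl⟩

/-! ### Inverting `T - t` off the essential spectrum. -/

/-- The operator `(T - t)(T - t - s)⁻¹ = 1 + s (T - t - s)⁻¹`. -/
theorem IsResolvent.exists_eq_one_add {T : E →ₗ.[𝕜] E} {t s : ℝ} {R : E →L[𝕜] E}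
    (hR : T.IsResolvent ((t + s : ℝ) : 𝕜) R) (x : E) :
    ∃ u : T.domain, (u : E) = R x ∧
      T u - (t : 𝕜) • (u : E) = (1 + (s : 𝕜) • R : E →L[𝕜] E) x := by
  obtain ⟨u, hu, hux⟩ := hR.1 x
  refine ⟨u, hu, ?_⟩
  simp only [_root_.add_apply, one_apply_eq_self,
    _root_.smul_apply, ← hu]
  rw [sub_eq_iff_eq_add.1 hux]
  push_cast
  module

/-- On the eigenspace `T - t - s` acts as `-s`, so `R` acts there as `-1 / s`. This lets the bounded
operator `1 + s R` stand in for `T - t`. -/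
theorem IsResolvent.ker_one_add {T : E →ₗ.[𝕜] E} {t s : ℝ} {R : E →L[𝕜] E}
    (hR : T.IsResolvent ((t + s : ℝ) : 𝕜) R) :
    (1 + (s : 𝕜) • R : E →L[𝕜] E).ker = (T.eigenspace (t : 𝕜)).map T.domain.subtype := by
  ext x
  rw [mem_map_eigenspace, LinearMap.mem_ker, ContinuousLinearMap.coe_coe]
  constructor
  · intro hx
    obtain ⟨u, hu, hux⟩ := hR.exists_eq_one_add x
    rw [hx] at hux
    have hx' : x = -((s : 𝕜) • R x) := by
      rw [eq_neg_iff_add_eq_zero]; simpa using hx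
    refine ⟨-((s : 𝕜) • u), ?_, ?_⟩
    · rw [hx', ← hu]; rfl
    · rw [map_neg, map_smul, Submodule.coe_neg, Submodule.coe_smul, sub_eq_zero.1 hux]
      module
  · rintro ⟨u, rfl, hu⟩
    have := hR.2 u
    rw [sub_eq_zero.1 hu, show (t : 𝕜) • (u : E) - ((t + s : ℝ) : 𝕜) • (u : E) = -((s : 𝕜) • (u : E))
      by push_cast; module, _root_.map_neg, _root_.map_smul] at this
    simp only [_root_.add_apply, one_apply_eq_self,
      _root_.smul_apply]
    rw [eq_neg_iff_add_eq_zero.1 this.symm]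

theorem IsResolvent.isSelfAdjoint_one_add [CompleteSpace E] {T : E →ₗ.[𝕜] E}
    (hT : T.IsFormalAdjoint T) {t : ℝ} (s : ℝ) {R : E →L[𝕜] E} (hR : T.IsResolvent (t : 𝕜) R) :
    IsSelfAdjoint (1 + (s : 𝕜) • R : E →L[𝕜] E) := by
  rw [ContinuousLinearMap.isSelfAdjoint_iff_isSymmetric]
  intro x y
  simp [inner_add_left, inner_add_right, inner_smul_left, inner_smul_right, hR.inner_left hT]

/-- If `t` is at most an isolated point of the spectrum of the symmetric operator `T`, then `T - t`
is boundedly invertible on the orthogonal complement of its kernel. -/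
theorem IsFormalAdjoint.exists_inverse_on_orthogonal [CompleteSpace E] {T : E →ₗ.[𝕜] E}
    (hT : T.IsFormalAdjoint T) {t s : ℝ} (hs : 0 < s)
    (hρ : ∀ a : ℝ, a ≠ 0 → |a| < 2 * s → ((t + a : ℝ) : 𝕜) ∈ T.resolventSet)
    [FiniteDimensional 𝕜 (T.eigenspace (t : 𝕜))] :
    ∃ C : ℝ, 0 < C ∧ ∀ v ∈ ((T.eigenspace (t : 𝕜)).map T.domain.subtype)ᗮ, ∃ u : T.domain,
      (u : E) ∈ ((T.eigenspace (t : 𝕜)).map T.domain.subtype)ᗮ ∧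
        T u - (t : 𝕜) • (u : E) = v ∧ ‖(u : E)‖ ≤ C * ‖v‖ := by
  set N := (T.eigenspace (t : 𝕜)).map T.domain.subtype with hN
  obtain ⟨R, hR⟩ := mem_resolventSet_iff.1 (hρ s hs.ne' (by rw [abs_of_pos hs]; linarith))
  set A : E →L[𝕜] E := 1 + (s : 𝕜) • R with hA
  have hAx : ∀ x, A x = x + (s : 𝕜) • R x := fun x => by simp [hA]
  have hker : A.ker = N := IsResolvent.ker_one_add hR
  have hsa : IsSelfAdjoint A := hR.isSelfAdjoint_one_add hT s
  have hcl : Nᗮ = A.range.topologicalClosure := by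
    rw [← hker, ContinuousLinearMap.orthogonal_ker, ← ContinuousLinearMap.star_eq_adjoint,
      hsa.star_eq]
  set K : ℝ := (2 * s)⁻¹ with hK
  have hK0 : 0 < K := by positivity
  have hRN : ∀ y ∈ Nᗮ, R y ∈ Nᗮ := by
    intro y hy
    rw [Submodule.mem_orthogonal] at hy ⊢
    intro w hw
    have hw0 : A w = 0 := by rw [← hker] at hw; exact hw
    have h1 : w = -((s : 𝕜) • R w) := by rw [eq_neg_iff_add_eq_zero, ← hAx, hw0]
    have h2 := hy w hw
    rw [h1, inner_neg_left, inner_smul_left, hR.inner_left hT, neg_eq_zero, mul_eq_zero] at h2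
    exact h2.resolve_left (by simpa using hs.ne')
  -- For `z = A x` this is the form estimate at `R x` and `R y`. The closure of the range is `Nᗮ`,
  -- so `z = R y` is admissible for `y ∈ Nᗮ`.
  have hform : ∀ y z, z ∈ A.range.topologicalClosure →
      RCLike.re ⟪z, R y⟫_𝕜 ≤ K * (‖z‖ * ‖A y‖) := by
    intro y z hz
    have hclosed : _root_.IsClosed {z : E | RCLike.re ⟪z, R y⟫_𝕜 ≤ K * (‖z‖ * ‖A y‖)} :=
      isClosed_le (by fun_prop) (by fun_prop)
    refine closure_minimal ?_ hclosed hz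
    rintro _ ⟨x, rfl⟩
    obtain ⟨u, hu, hux⟩ := hR.exists_eq_one_add x
    obtain ⟨v, hv, hvy⟩ := hR.exists_eq_one_add y
    have := hT.re_inner_le hs hρ u v
    rw [hux, hvy, hv] at this
    exact this
  have hbound : ∀ y ∈ Nᗮ, ‖R y‖ ≤ K * ‖A y‖ := by
    intro y hy
    have h1 := hform y (R y) (hcl ▸ hRN y hy)
    rw [inner_self_eq_norm_sq] at h1
    rcases (norm_nonneg (R y)).eq_or_lt with h0 | h0
    · rw [← h0]; positivity
    · nlinarith
  have hanti : ∀ y : Nᗮ, ‖y‖ ≤ (1 + s * K) * ‖(A ∘L Nᗮ.subtypeL) y‖ := by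
    intro y
    have h1 : (y : E) = A y - (s : 𝕜) • R y := by rw [hAx]; abel
    have h2 : ‖(y : E)‖ ≤ ‖A y‖ + s * ‖R y‖ := by
      conv_lhs => rw [h1]
      refine (norm_sub_le _ _).trans ?_
      rw [norm_smul, RCLike.norm_ofReal, abs_of_pos hs]
    have h3 := mul_le_mul_of_nonneg_left (hbound y y.2) hs.le
    change ‖(y : E)‖ ≤ (1 + s * K) * ‖A y‖
    linarith
  -- `A` is bounded below on `Nᗮ`, so its image there is closed; being dense in `Nᗮ`, it contains
  -- all of it.
  have hrange : _root_.IsClosed (Set.range (A ∘L Nᗮ.subtypeL)) :=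
    (ContinuousLinearMap.antilipschitz_of_bound (K := ⟨1 + s * K, by positivity⟩) _
      hanti).isClosed_range (A ∘L Nᗮ.subtypeL).uniformContinuous
  refine ⟨K, hK0, fun v hv => ?_⟩
  obtain ⟨y, hy⟩ : v ∈ Set.range (A ∘L Nᗮ.subtypeL) := by
    rw [hcl] at hv
    refine closure_minimal ?_ hrange hv
    rintro _ ⟨x, rfl⟩
    refine ⟨⟨x - N.starProjection x, N.sub_starProjection_mem_orthogonal x⟩, ?_⟩
    have : A (N.starProjection x) = 0 := by
      have h1 : N.starProjection x ∈ A.ker := by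
        rw [hker]; exact N.starProjection_apply_mem x
      exact h1
    simp [_root_.map_sub, this]
  obtain ⟨u, hu, huy⟩ := hR.exists_eq_one_add (y : E)
  refine ⟨u, hu ▸ hRN y y.2, huy.trans hy, ?_⟩
  rw [hu, ← hy]
  exact hbound y y.2

/-- Off the essential spectrum, `T - t` is a Fredholm operator. -/
theorem IsFormalAdjoint.exists_inverse_of_notMem_essentialSpectrum [CompleteSpace E]
    {T : E →ₗ.[𝕜] E} (hT : T.IsFormalAdjoint T) {t : ℝ} (ht : (t : 𝕜) ∉ T.essentialSpectrum) :
    FiniteDimensional 𝕜 (T.eigenspace (t : 𝕜)) ∧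
    ∃ C : ℝ, 0 < C ∧ ∀ v ∈ ((T.eigenspace (t : 𝕜)).map T.domain.subtype)ᗮ, ∃ u : T.domain,
      (u : E) ∈ ((T.eigenspace (t : 𝕜)).map T.domain.subtype)ᗮ ∧
        T u - (t : 𝕜) • (u : E) = v ∧ ‖(u : E)‖ ≤ C * ‖v‖ := by
  by_cases hσ : (t : 𝕜) ∈ T.spectrum
  · obtain ⟨-, hacc, -, hfin⟩ : (t : 𝕜) ∈ T.discreteSpectrum := by
      by_contra h
      exact ht ⟨hσ, h⟩
    refine ⟨hfin, ?_⟩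
    rw [accPt_iff_nhds] at hacc
    push Not at hacc
    obtain ⟨U, hU, hUt⟩ := hacc
    obtain ⟨ε, hε, hball⟩ := Metric.mem_nhds_iff.1 hU
    refine hT.exists_inverse_on_orthogonal (half_pos hε) fun a ha haε => ?_
    by_contra hmem
    have hd : ((t + a : ℝ) : 𝕜) ∈ Metric.ball (t : 𝕜) ε := by
      rw [Metric.mem_ball, dist_eq_norm, ← RCLike.ofReal_sub, RCLike.norm_ofReal]
      simpa [mul_div_cancel₀] using haε
    have := hUt _ ⟨hball hd, hmem⟩
    rw [RCLike.ofReal_inj] at this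
    exact ha (by linarith)
  · obtain ⟨R, hR⟩ : (t : 𝕜) ∈ T.resolventSet := by simpa [LinearPMap.spectrum] using hσ
    have hbot : T.eigenspace (t : 𝕜) = ⊥ := by
      rw [eq_bot_iff]
      intro u hu
      have h1 : T u - (t : 𝕜) • (u : E) = 0 := hu
      have h2 := hR.2 u
      rw [h1, _root_.map_zero] at h2
      exact (Submodule.mem_bot 𝕜).2 (Subtype.ext h2.symm)
    rw [hbot]
    refine ⟨inferInstance, ‖R‖ + 1, by positivity, fun v _ => ?_⟩
    obtain ⟨u, hu, huv⟩ := hR.1 v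
    refine ⟨u, by simp, huv, ?_⟩
    rw [hu]
    refine (R.le_opNorm v).trans ?_
    gcongr
    linarith

/-- The solutions of `T u - z u ∈ V` for a finite dimensional `V` form a finite dimensional space
if the eigenspace of `z` is finite dimensional. -/
theorem finiteDimensional_comap_sub_smul (T : E →ₗ.[𝕜] E) (z : 𝕜)
    [FiniteDimensional 𝕜 (T.eigenspace z)] (V : Submodule 𝕜 E) [FiniteDimensional 𝕜 V] :
    FiniteDimensional 𝕜 (V.comap (T.toFun - z • T.domain.subtype)) := by
  rw [← Submodule.fg_iff_finiteDimensional]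
  refine Submodule.fg_of_fg_map_of_fg_inf_ker (T.toFun - z • T.domain.subtype) ?_ ?_
  · have := Submodule.finiteDimensional_of_le
      (Submodule.map_comap_le (T.toFun - z • T.domain.subtype) V)
    exact (Submodule.fg_iff_finiteDimensional _).2 this
  · have : FiniteDimensional 𝕜 (LinearMap.ker (T.toFun - z • T.domain.subtype)) :=
      inferInstanceAs (FiniteDimensional 𝕜 (T.eigenspace z))
    have := Submodule.finiteDimensional_of_le (inf_le_right :
      V.comap (T.toFun - z • T.domain.subtype) ⊓
        LinearMap.ker (T.toFun - z • T.domain.subtype) ≤ _)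
    exact (Submodule.fg_iff_finiteDimensional _).2 this

end LinearPMap

namespace DenselyDefinedForm

variable {𝕜 E : Type*} [RCLike 𝕜] [NormedAddCommGroup E] [InnerProductSpace 𝕜 E]

/-! ### The quadratic form and its operator. -/

theorem re_form_comm (h : DenselyDefinedForm 𝕜 E) (u v : h.domain) :
    RCLike.re (h.form u v) = RCLike.re (h.form v u) := by
  rw [← h.symm u v, RCLike.conj_re]

theorem quad_add (h : DenselyDefinedForm 𝕜 E) (u v : h.domain) :
    h.quad (u + v) = h.quad u + 2 * RCLike.re (h.form u v) + h.quad v := by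
  simp only [quad, map_add, LinearMap.add_apply]
  rw [h.re_form_comm v u]
  ring

theorem quad_real_smul (h : DenselyDefinedForm 𝕜 E) (x : ℝ) (u : h.domain) :
    h.quad ((x : 𝕜) • u) = x ^ 2 * h.quad u := by
  simp only [quad, LinearMap.map_smulₛₗ, LinearMap.smul_apply, smul_eq_mul, RingHom.id_apply,
    RCLike.conj_ofReal, RCLike.re_ofReal_mul]
  ring

theorem quad_sub_real_smul (h : DenselyDefinedForm 𝕜 E) (x : ℝ) (u v : h.domain) :
    h.quad (v - (x : 𝕜) • u) =
      h.quad v - 2 * x * RCLike.re (h.form v u) + x ^ 2 * h.quad u := by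
  have : v - (x : 𝕜) • u = v + ((-x : ℝ) : 𝕜) • u := by push_cast; module
  rw [this, quad_add, quad_real_smul, map_smul, smul_eq_mul, RCLike.re_ofReal_mul]
  ring

theorem exists_coe_eq_of_mem_operator_domain (h : DenselyDefinedForm 𝕜 E)
    (u : h.operator.domain) :
    ∃ w : h.domain, (w : E) = u ∧ ∀ v : h.domain, h.form v w = ⟪(v : E), h.operator u⟫_𝕜 := by
  have := h.operator.mem_graph u
  rw [graph_operator] at this
  exact this

theorem operator_domain_le (h : DenselyDefinedForm 𝕜 E) : h.operator.domain ≤ h.domain := by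
  intro x hx
  obtain ⟨w, hw, -⟩ := h.exists_coe_eq_of_mem_operator_domain ⟨x, hx⟩
  have := w.2
  rwa [hw] at this

theorem operator_isFormalAdjoint (h : DenselyDefinedForm 𝕜 E) :
    h.operator.IsFormalAdjoint h.operator := by
  intro u v
  obtain ⟨u', hu', hu⟩ := h.exists_coe_eq_of_mem_operator_domain u
  obtain ⟨v', hv', hv⟩ := h.exists_coe_eq_of_mem_operator_domain v
  rw [← hu', ← hv, ← h.symm v' u', hu, inner_conj_symm, hv']

/-! ### Lower bounds in finite codimension and their improvement. -/

/-- The lower bounds of the form on the orthogonal complements of finite dimensional subspaces of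
the form domain. -/
def finiteCodimLowerBounds (h : DenselyDefinedForm 𝕜 E) : Set ℝ :=
  {t | ∃ V : Submodule 𝕜 E, V ≤ h.domain ∧ FiniteDimensional 𝕜 V ∧
    ∀ u : h.domain, (u : E) ∈ Vᗮ → t * ‖(u : E)‖ ^ 2 ≤ h.quad u}

theorem IsLowerBound.mem_finiteCodimLowerBounds {h : DenselyDefinedForm 𝕜 E} {c : ℝ}
    (hc : h.IsLowerBound c) : c ∈ h.finiteCodimLowerBounds :=
  ⟨⊥, bot_le, inferInstance, fun u _ => hc u⟩

/-- Off the essential spectrum, a lower bound close to `t` can be improved to one beyond `t`. -/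
theorem exists_improved_lowerBound [CompleteSpace E] (h : DenselyDefinedForm 𝕜 E) {t : ℝ}
    (ht : (t : 𝕜) ∉ h.operator.essentialSpectrum) :
    ∃ ε > 0, ∀ r ∈ h.finiteCodimLowerBounds, t - ε ≤ r →
      t + ε ∈ h.finiteCodimLowerBounds := by
  have hT := h.operator_isFormalAdjoint
  obtain ⟨hfin, C, hC, hinv⟩ := hT.exists_inverse_of_notMem_essentialSpectrum ht
  set T := h.operator with hTdef
  set N := (T.eigenspace (t : 𝕜)).map T.domain.subtype with hN
  refine ⟨1 / (5 * C), by positivity, ?_⟩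
  rintro r ⟨V, hVh, hVfin, hV⟩ hr
  -- Orthogonality of `v` to `Y` makes `u = (T - t)⁻¹ v` orthogonal to `V`, by symmetry of `T - t`.
  set Y := (V ⊔ N).comap (T.toFun - (t : 𝕜) • T.domain.subtype) with hY
  have hYfin : FiniteDimensional 𝕜 Y := T.finiteDimensional_comap_sub_smul (t : 𝕜) (V ⊔ N)
  have hdom : ∀ P : Submodule 𝕜 T.domain, P.map T.domain.subtype ≤ h.domain := by
    rintro P _ ⟨u, -, rfl⟩
    exact h.operator_domain_le u.2
  refine ⟨V ⊔ N ⊔ Y.map T.domain.subtype, sup_le (sup_le hVh (hdom _)) (hdom _), inferInstance, ?_⟩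
  intro v hv
  have hvV : (v : E) ∈ Vᗮ := Submodule.orthogonal_le (le_sup_left.trans le_sup_left) hv
  have hvN : (v : E) ∈ Nᗮ := Submodule.orthogonal_le (le_sup_right.trans le_sup_left) hv
  have hvY : (v : E) ∈ (Y.map T.domain.subtype)ᗮ := Submodule.orthogonal_le le_sup_right hv
  obtain ⟨u, huN, huv, hnorm⟩ := hinv v hvN
  have huV : (u : E) ∈ Vᗮ := by
    rw [Submodule.mem_orthogonal]
    intro w hw
    obtain ⟨y, hyN, hyw, -⟩ := hinv (w - N.starProjection w)
      (N.sub_starProjection_mem_orthogonal w)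
    have hyY : y ∈ Y := by
      change T y - (t : 𝕜) • (y : E) ∈ V ⊔ N
      rw [hyw]
      exact sub_mem (Submodule.mem_sup_left hw)
        (Submodule.mem_sup_right (N.starProjection_apply_mem w))
    have h1 : ⟪(y : E), (v : E)⟫_𝕜 = 0 :=
      (Submodule.mem_orthogonal _ _).1 hvY _ ⟨y, hyY, rfl⟩
    have h2 : ⟪N.starProjection w, (u : E)⟫_𝕜 = 0 :=
      (Submodule.mem_orthogonal _ _).1 huN _ (N.starProjection_apply_mem w)
    rw [← huv, ← hT.inner_sub_smul, hyw, inner_sub_left, h2, sub_zero] at h1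
    exact h1
  obtain ⟨w, hwu, hw⟩ := h.exists_coe_eq_of_mem_operator_domain u
  replace hw : ∀ z : h.domain, h.form z w = ⟪(z : E), T u⟫_𝕜 := hw
  have hform : ∀ z : h.domain, h.form z w = ⟪(z : E), (v : E)⟫_𝕜 + (t : 𝕜) * ⟪(z : E), (u : E)⟫_𝕜 := by
    intro z
    rw [hw, ← huv, inner_sub_right, inner_smul_right, sub_add_cancel]
  set b := RCLike.re ⟪(v : E), (u : E)⟫_𝕜 with hb
  have hvw : RCLike.re (h.form v w) = ‖(v : E)‖ ^ 2 + t * b := by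
    rw [hform, map_add, inner_self_eq_norm_sq, RCLike.re_ofReal_mul]
  have hww : h.quad w = b + t * ‖(u : E)‖ ^ 2 := by
    rw [quad, hform, map_add, RCLike.re_ofReal_mul, hwu, inner_self_eq_norm_sq, inner_re_symm]
  have hbabs : |b| ≤ C * ‖(v : E)‖ ^ 2 := by
    calc |b| ≤ ‖(v : E)‖ * ‖(u : E)‖ := (RCLike.abs_re_le_norm _).trans (norm_inner_le_norm _ _)
      _ ≤ ‖(v : E)‖ * (C * ‖(v : E)‖) := by gcongr
      _ = _ := by ring
  have hu2 : ‖(u : E)‖ ^ 2 ≤ C ^ 2 * ‖(v : E)‖ ^ 2 := by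
    rw [← mul_pow]; gcongr
  set c : ℝ := 1 / (5 * C) with hc
  have hc0 : 0 < c := by positivity
  have hcC : c * (5 * C) = 1 := one_div_mul_cancel (by positivity)
  -- With `b` and `k` as below, the test gives `h(v) - t n ≥ 5 c n - 3 c² b - 9 c³ k`. As `c b ≤ n /
  -- 5` and `c² k ≤ n / 25`, this exceeds `c n`.
  set x : ℝ := 3 * c with hx
  have hq := hV (v - (x : 𝕜) • w) (by
    rw [Submodule.coe_sub, Submodule.coe_smul, hwu]
    exact sub_mem hvV (Submodule.smul_mem _ _ huV))
  have hq' : (t - c) * ‖((v - (x : 𝕜) • w : h.domain) : E)‖ ^ 2 ≤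
      h.quad (v - (x : 𝕜) • w) := (mul_le_mul_of_nonneg_right hr (sq_nonneg _)).trans hq
  rw [quad_sub_real_smul, hvw, hww, Submodule.coe_sub, Submodule.coe_smul, hwu,
    norm_sub_sq (𝕜 := 𝕜), inner_smul_right, RCLike.re_ofReal_mul, norm_smul, RCLike.norm_ofReal,
    mul_pow, sq_abs, ← hb] at hq'
  set n := ‖(v : E)‖ ^ 2
  set k := ‖(u : E)‖ ^ 2
  have hb' : c * (5 * c * b) ≤ c * n := by
    gcongr
    calc 5 * c * b ≤ 5 * c * (C * n) := by gcongr; exact (le_abs_self b).trans hbabs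
      _ = (c * (5 * C)) * n := by ring
      _ = n := by rw [hcC, one_mul]
  have hk' : c * (25 * c ^ 2 * k) ≤ c * n := by
    gcongr
    calc 25 * c ^ 2 * k ≤ 25 * c ^ 2 * (C ^ 2 * n) := by gcongr
      _ = (c * (5 * C)) ^ 2 * n := by ring
      _ = n := by rw [hcC, one_pow, one_mul]
  have hn : 0 ≤ c * n := by positivity
  rw [hx] at hq'
  linarith

/-! ### Weakly null sequences. -/

theorem _root_.tendsto_inner_of_tendsto_toWeakSpace {f : ℕ → E}
    (hf : Tendsto (fun n => toWeakSpace 𝕜 E (f n)) atTop (𝓝 0)) (y : E) :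
    Tendsto (fun n => ⟪y, f n⟫_𝕜) atTop (𝓝 0) := by
  have := ((WeakBilin.eval_continuous (topDualPairing 𝕜 E).flip (innerSL 𝕜 y)).tendsto 0).comp hf
  have h0 : (topDualPairing 𝕜 E).flip 0 (innerSL 𝕜 y) = 0 := (innerSL 𝕜 y).map_zero
  exact h0 ▸ this

/-- A weakly null sequence in the form domain can be approximated in the form sense by a sequence
orthogonal to a given finite dimensional subspace. -/
theorem exists_tendsto_zero_sub_mem_orthogonal (h : DenselyDefinedForm 𝕜 E) {f : ℕ → h.domain}
    (hf : Tendsto (fun n => toWeakSpace 𝕜 E (f n : E)) atTop (𝓝 0)) {V : Submodule 𝕜 E}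
    (hV : V ≤ h.domain) [FiniteDimensional 𝕜 V] :
    ∃ g : ℕ → h.domain, (∀ n, ((f n - g n : h.domain) : E) ∈ Vᗮ) ∧
      Tendsto (fun n => ‖(g n : E)‖) atTop (𝓝 0) ∧ Tendsto (fun n => h.quad (g n)) atTop (𝓝 0) := by
  let b := stdOrthonormalBasis 𝕜 V
  let e : Fin (Module.finrank 𝕜 V) → h.domain := fun i => ⟨b i, hV (b i).2⟩
  have ha : ∀ i, Tendsto (fun n => ⟪(e i : E), (f n : E)⟫_𝕜) atTop (𝓝 0) := fun i =>
    tendsto_inner_of_tendsto_toWeakSpace hf _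
  have hcoe : ∀ n, ((∑ i, ⟪(e i : E), (f n : E)⟫_𝕜 • e i : h.domain) : E) =
      ∑ i, ⟪(e i : E), (f n : E)⟫_𝕜 • (e i : E) := fun n => by simp
  refine ⟨fun n => ∑ i, ⟪(e i : E), (f n : E)⟫_𝕜 • e i, fun n => ?_, ?_, ?_⟩
  · have : ((∑ i, ⟪(e i : E), (f n : E)⟫_𝕜 • e i : h.domain) : E) = V.starProjection (f n) := by
      rw [hcoe, Submodule.starProjection_apply, ← b.sum_repr' (V.orthogonalProjectionOnto (f n : E))]
      simp [e]
    rw [Submodule.coe_sub, this]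
    exact V.sub_starProjection_mem_orthogonal _
  · simp only [hcoe]
    have : Tendsto (fun n => ∑ i, ⟪(e i : E), (f n : E)⟫_𝕜 • (e i : E)) atTop (𝓝 0) := by
      simpa using tendsto_finsetSum Finset.univ fun i _ => (ha i).smul_const (e i : E)
    simpa using this.norm
  · have hform : Tendsto (fun n => h.form (∑ i, ⟪(e i : E), (f n : E)⟫_𝕜 • e i)
        (∑ i, ⟪(e i : E), (f n : E)⟫_𝕜 • e i)) atTop (𝓝 0) := by
      simp only [map_sum, LinearMap.sum_apply, LinearMap.map_smulₛₗ, LinearMap.smul_apply,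
        smul_eq_mul, RingHom.id_apply]
      have h1 : ∀ i j, Tendsto (fun n => ⟪(e i : E), (f n : E)⟫_𝕜 *
          (conj ⟪(e j : E), (f n : E)⟫_𝕜 * h.form (e j) (e i))) atTop (𝓝 0) := fun i j => by
        simpa using (ha i).mul
          (((RCLike.continuous_conj.tendsto _).comp (ha j)).mul_const (h.form (e j) (e i)))
      simpa [Finset.mul_sum] using tendsto_finsetSum Finset.univ fun i _ =>
        tendsto_finsetSum Finset.univ fun j _ => h1 i j
    have := (RCLike.continuous_re.tendsto _).comp hform
    rwa [map_zero] at this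

/-- Lower bounds on spaces of finite codimension bound the form along normalized weakly null
sequences. -/
theorem le_liminf_quad (h : DenselyDefinedForm 𝕜 E) (h_bdd : h.IsBoundedBelow)
    {f : ℕ → h.domain} (f_norm : ∀ n, ‖(f n : E)‖ = 1)
    (f_weak : Tendsto (fun n => toWeakSpace 𝕜 E (f n : E)) atTop (𝓝 0)) {t : ℝ}
    (ht : t ∈ h.finiteCodimLowerBounds) :
    (t : EReal) ≤ liminf (fun n => ((h.quad (f n) : ℝ) : EReal)) atTop := by
  obtain ⟨c, hc⟩ := h_bdd
  obtain ⟨V, hVh, hVfin, hV⟩ := ht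
  obtain ⟨g, hg, hg0, hq0⟩ := h.exists_tendsto_zero_sub_mem_orthogonal f_weak hVh
  refine EReal.ge_of_forall_gt_iff_ge.1 fun a ha => ?_
  rw [EReal.coe_lt_coe_iff] at ha
  refine le_liminf_of_le (by isBoundedDefault) ?_
  simp only [EReal.coe_le_coe_iff]
  rcases le_or_gt a c with hac | hac
  · refine Eventually.of_forall fun n => hac.trans ?_
    simpa [f_norm] using hc (f n)
  -- Chosen so that `η (a - c)` is half the gap `t - a`.
  set η : ℝ := (t - a) / (2 * (a - c)) with hη
  have hac' : 0 < a - c := by linarith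
  have hη0 : 0 < η := div_pos (by linarith) (by linarith)
  have hηa : (1 + η) * (a - c) < t - c := by
    have : η * (a - c) = (t - a) / 2 := by rw [hη]; field_simp
    linarith
  have hD : Tendsto (fun n => ‖((f n - g n : h.domain) : E)‖) atTop (𝓝 1) := by
    rw [tendsto_iff_dist_tendsto_zero]
    refine squeeze_zero (fun _ => dist_nonneg) (fun n => ?_) hg0
    rw [Real.dist_eq, ← f_norm n, Submodule.coe_sub]
    simpa using abs_norm_sub_norm_le ((f n : E) - g n) (f n)
  have hlim : Tendsto (fun n => (t - c) * ‖((f n - g n : h.domain) : E)‖ ^ 2 -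
      (1 + η⁻¹) * (h.quad (g n) - c * ‖(g n : E)‖ ^ 2)) atTop (𝓝 (t - c)) := by
    simpa using ((hD.pow 2).const_mul (t - c)).sub
      ((hq0.sub ((hg0.pow 2).const_mul c)).const_mul (1 + η⁻¹))
  filter_upwards [hlim.eventually (lt_mem_nhds hηa)] with n hn
  -- Nonnegativity of `h - c` at `g n + η f n` is a Young inequality. It absorbs the cross term of
  -- `f n` and `g n` into a small multiple of `h(f n) - c`, although `h(f n)` need not be bounded.
  have h1 := hc (g n - ((-η : ℝ) : 𝕜) • f n)
  have h2 := hV (f n - g n) (hg n)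
  have e2 : f n - g n = f n - ((1 : ℝ) : 𝕜) • g n := by simp
  have h3 : ‖((f n - g n : h.domain) : E)‖ ^ 2 =
      1 - 2 * RCLike.re ⟪(g n : E), (f n : E)⟫_𝕜 + ‖(g n : E)‖ ^ 2 := by
    rw [Submodule.coe_sub, norm_sub_sq (𝕜 := 𝕜), f_norm, inner_re_symm, one_pow]
  rw [quad_sub_real_smul, Submodule.coe_sub, Submodule.coe_smul, norm_sub_sq (𝕜 := 𝕜),
    inner_smul_right, RCLike.re_ofReal_mul, norm_smul, RCLike.norm_ofReal, f_norm, mul_pow,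
    sq_abs] at h1
  rw [e2, quad_sub_real_smul, h.re_form_comm, ← e2] at h2
  have h4 := mul_le_mul_of_nonneg_left h1 (inv_nonneg.2 hη0.le)
  have h5 : η⁻¹ * η = 1 := inv_mul_cancel₀ hη0.ne'
  generalize ‖((f n - g n : h.domain) : E)‖ ^ 2 = D at *
  generalize RCLike.re ⟪(g n : E), (f n : E)⟫_𝕜 = I at *
  generalize RCLike.re (h.form (g n) (f n)) = F at *
  have h6 : η⁻¹ * (c * (‖(g n : E)‖ ^ 2 - 2 * (-η * I) + (-η) ^ 2 * 1 ^ 2)) =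
      c * (η⁻¹ * ‖(g n : E)‖ ^ 2 + 2 * I + η) := by
    linear_combination c * (2 * I + η) * h5
  have h7 : η⁻¹ * (h.quad (g n) - 2 * -η * F + (-η) ^ 2 * h.quad (f n)) =
      η⁻¹ * h.quad (g n) + 2 * F + η * h.quad (f n) := by
    linear_combination (2 * F + η * h.quad (f n)) * h5
  rw [h6, h7] at h4
  have h8 : (1 + η) * (a - c) < (1 + η) * (h.quad (f n) - c) := by
    have h9 : c * D = c * (1 - 2 * I + ‖(g n : E)‖ ^ 2) := by rw [h3]
    linarith
  have := lt_of_mul_lt_mul_left h8 (by positivity)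
  linarith

/-! ### Conclusion. -/

/-- The bottom of the essential spectrum is a lower bound for the form along normalized weakly null
sequences. -/
theorem essentialSpectrumBottom_le_liminf_quad [CompleteSpace E] (h : DenselyDefinedForm 𝕜 E)
    (h_bdd : h.IsBoundedBelow) {f : ℕ → h.domain} (f_norm : ∀ n, ‖(f n : E)‖ = 1)
    (f_weak : Tendsto (fun n => toWeakSpace 𝕜 E (f n : E)) atTop (𝓝 0)) :
    h.operator.essentialSpectrumBottom ≤
      liminf (fun n => ((h.quad (f n) : ℝ) : EReal)) atTop := by
  have hle : ∀ t ∈ h.finiteCodimLowerBounds,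
      (t : EReal) ≤ liminf (fun n => ((h.quad (f n) : ℝ) : EReal)) atTop :=
    fun t ht => h.le_liminf_quad h_bdd f_norm f_weak ht
  generalize liminf (fun n => ((h.quad (f n) : ℝ) : EReal)) atTop = L at hle ⊢
  obtain ⟨c, hc⟩ := h_bdd
  have hcG := hc.mem_finiteCodimLowerBounds
  induction L with
  | bot => simpa using hle c hcG
  | top => exact le_top
  | coe l =>
    simp only [EReal.coe_le_coe_iff] at hle
    have hbdd : BddAbove h.finiteCodimLowerBounds := ⟨l, hle⟩
    set t := sSup h.finiteCodimLowerBounds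
    -- Some lower bound lies within `ε` of the supremum `t`; improving it to `t + ε` would
    -- contradict maximality.
    have hmem : (t : 𝕜) ∈ h.operator.essentialSpectrum := by
      by_contra hmem
      obtain ⟨ε, hε, himp⟩ := h.exists_improved_lowerBound hmem
      obtain ⟨r, hr, hlt⟩ := exists_lt_of_lt_csSup ⟨c, hcG⟩ (sub_lt_self t hε)
      have := le_csSup hbdd (himp r hr hlt.le)
      linarith
    calc h.operator.essentialSpectrumBottom ≤ ((RCLike.re (t : 𝕜) : ℝ) : EReal) :=
        iInf₂_le (t : 𝕜) hmem
      _ ≤ (l : EReal) := by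
        rw [RCLike.ofReal_re, EReal.coe_le_coe_iff]
        exact csSup_le ⟨c, hcG⟩ hle

end DenselyDefinedForm

theorem proposition2p1 {𝕜 X : Type*} [RCLike 𝕜] [MeasurableSpace X] (m : Measure X)
    (h : DenselyDefinedForm 𝕜 (Lp 𝕜 2 m)) (h_bdd : h.IsBoundedBelow) (h_closed : h.IsClosed)
    (f : ℕ → h.domain) (f_norm : ∀ n, ‖(f n : Lp 𝕜 2 m)‖ = 1)
    (f_weak : Tendsto (fun n => toWeakSpace 𝕜 (Lp 𝕜 2 m) (f n : Lp 𝕜 2 m)) atTop (𝓝 0)) :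
    h.operator.essentialSpectrumBottom ≤
      liminf (fun n => ((h.quad (f n) : ℝ) : EReal)) atTop :=
  h.essentialSpectrumBottom_le_liminf_quad h_bdd f_norm f_weak
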